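/- Let $k$ be a field, let $P=k[x_1,\dots,x_c]$ be the polynomial ring in $c$ variables with its standard grading, let $I\subseteq P$ be an ideal generated by homogeneous forms of degree at least two, and suppose that $S=P/I$ is Artinian; thus $S=\bigoplus_{i\ge 0}[S]_i$ is a standard graded Artinian $k$-algebra of codimension $c$. Put $\operatorname{HF}_S(i)=\dim_k[S]_i$ and $S_+=\bigoplus_{i\ge 1}[S]_i$. The socle of $S$ is $0:_SS_+=\{s\in S\mid sS_+=0\}$, the type of $S$ is the $k$-dimension of its socle, the socle degree of $S$ is the largest $e$ with $[S]_e\ne 0$, and $S$ is level if its socle is concentrated in a single degree. A level algebra $S$ of socle degree $e$ and type $r$ is called compressed if $$\operatorname{HF}_S(i)=\min\{\dim_k[P]_i,\ r\cdot\dim_k[P]_{e-i}\}\quad\text{for all } 0\le i\le e.$$ An exact zero divisor of $S$ is a nonzero element $a\in S$ for which there is a nonzero $b\in S$ with $(0:_Sa)=(b)$ and $(0:_Sb)=(a)$. **Proposition 3.9.** Let $S$ be, as above, a compressed level algebra with socle degree $e$, type $r$ and codimension $c$. If either (a) $r=1$, $e\ge 2$, $e\ne 3$ and $c\ge 3$,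 or (b) $c$, $e$ and $r$ are all at least $2$ and $(c,e,r)\ne(c,2,c-1)$, then $S$ has no homogeneous exact zero divisors. -/

import Mathlib

open MvPolynomial

noncomputable section

/-- `(a, b)` is an exact pair of zero divisors of the commutative ring `S`:
`a` and `b` are nonzero, `(0 :_S a) = (b)` and `(0 :_S b) = (a)`.
As `a * b = 0`, asking that `a` and `b` be nonzero is the same as asking that both be zero
divisors; this excludes the degenerate pair consisting of a unit and `0`. -/
structure IsExactPair {S : Type*} [CommRing S] (a b : S) : Prop where
  left_ne_zero : a ≠ 0
  right_ne_zero : b ≠ 0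
  annihilator_left : (Ideal.span {a}).annihilator = Ideal.span {b}
  annihilator_right : (Ideal.span {b}).annihilator = Ideal.span {a}

/-- `a` is an exact zero divisor: it is a member of an exact pair of zero divisors. -/
def IsExactZeroDivisor {S : Type*} [CommRing S] (a : S) : Prop :=
  ∃ b : S, IsExactPair a b

namespace GradedQuotient

variable {k : Type*} [Field k] {c : ℕ}

/-- The ideal `I` of `P = k[x_1, …, x_c]` is generated by homogeneous forms of degree at
least two. -/
def GeneratedInDegreeGETwo (I : Ideal (MvPolynomial (Fin c) k)) : Prop :=
  ∃ G : Set (MvPolynomial (Fin c) k),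
    (∀ g ∈ G, ∃ d : ℕ, 2 ≤ d ∧ g.IsHomogeneous d) ∧ I = Ideal.span G

/-- The homogeneous component `[S]_i` of `S = P / I`: the image of the forms of degree `i`. -/
def component (I : Ideal (MvPolynomial (Fin c) k)) (i : ℕ) :
    Submodule k (MvPolynomial (Fin c) k ⧸ I) :=
  (homogeneousSubmodule (Fin c) k i).map (Ideal.Quotient.mkₐ k I).toLinearMap

/-- The Hilbert function `HF_S(i) = dim_k [S]_i` of `S = P / I`. -/
def hilbertFunction (I : Ideal (MvPolynomial (Fin c) k)) (i : ℕ) : ℕ :=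
  Module.finrank k (component I i)

/-- The ideal `S_+ = ∑_{i ≥ 1} [S]_i` of `S = P / I`. -/
def irrelevant (I : Ideal (MvPolynomial (Fin c) k)) : Ideal (MvPolynomial (Fin c) k ⧸ I) :=
  Ideal.span {s | ∃ i : ℕ, 1 ≤ i ∧ s ∈ component I i}

/-- The socle `0 :_S S_+` of `S = P / I`, as a `k`-vector space. -/
def socle (I : Ideal (MvPolynomial (Fin c) k)) : Submodule k (MvPolynomial (Fin c) k ⧸ I) :=
  (irrelevant I).annihilator.restrictScalars k

/-- The type of `S = P / I`: the dimension of its socle. -/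
def type (I : Ideal (MvPolynomial (Fin c) k)) : ℕ :=
  Module.finrank k (socle I)

/-- `S = P / I` is level: its socle is concentrated in one degree. -/
def IsLevel (I : Ideal (MvPolynomial (Fin c) k)) : Prop :=
  ∃ d : ℕ, socle I ≤ component I d

/-- `e` is the socle degree of `S = P / I`: the largest degree in which `S` is nonzero. For a
level Artinian `S` this is the one degree in which the socle lives. -/
def HasSocleDegree (I : Ideal (MvPolynomial (Fin c) k)) (e : ℕ) : Prop :=
  IsGreatest {i : ℕ | component I i ≠ ⊥} e

/-- `S = P / I` is a compressed level algebra with socle degree `e` and type `r`. -/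
structure IsCompressedLevel (I : Ideal (MvPolynomial (Fin c) k)) (e r : ℕ) : Prop where
  isLevel : IsLevel I
  hasSocleDegree : HasSocleDegree I e
  type_eq : type I = r
  hilbertFunction_eq : ∀ i : ℕ, i ≤ e →
    hilbertFunction I i =
      min (Module.finrank k (homogeneousSubmodule (Fin c) k i))
        (r * Module.finrank k (homogeneousSubmodule (Fin c) k (e - i)))

end GradedQuotient

end

/-! The obstruction is purely numerical. Let h and H be the Hilbert functions of P and S, zero in
negative degrees. A homogeneous exact zero divisor f has a homogeneous partner g
(`exists_homogeneous_partner`); let d₁, d₂ be their degrees and D = d₁ + d₂. Since (0 : f) = (g) and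
(0 : g) = (f), multiplications by f and g alternate in an exact sequence; where its ends vanish,
H(i) + H(i - D) = H(i - d₂) + H(i - D - d₂), and likewise with d₁, d₂ exchanged
(`finrank_intComponent_of_isExactPair`).

As P is a domain, fg is a nonzero form in I, so H(D) < h(D), and compressedness forces e < 2D. Put j
= e - D. Up to degree j, H equals h, so the relations at i = e become equations between values of h.
They contradict the growth and convexity of h, except in some cases with d₁ = d₂, where i = e - 1
gives the contradiction. That degree is available only if d₁ ≥ 2; the excluded triples are what d₁ =
d₂ = 1 would allow. -/

/-! ### Growth and convexity of the Hilbert function of P. -/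

/-- The Hilbert function of a polynomial ring in `c` variables, extended by zero to `ℤ`. -/
def polyHilbert (c : ℕ) (i : ℤ) : ℤ := if i < 0 then 0 else (Nat.multichoose c i.toNat : ℤ)

namespace polyHilbert

lemma of_neg (c : ℕ) {i : ℤ} (hi : i < 0) : polyHilbert c i = 0 := by simp [polyHilbert, hi]

@[simp] lemma natCast (c n : ℕ) : polyHilbert c (n : ℤ) = Nat.multichoose c n := by
  simp [polyHilbert]

lemma zero (c : ℕ) : polyHilbert c 0 = 1 := by
  simpa using natCast c 0

lemma one (c : ℕ) : polyHilbert c 1 = c := by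
  simpa using natCast c 1

lemma nonneg (c : ℕ) (i : ℤ) : 0 ≤ polyHilbert c i := by
  unfold polyHilbert; split_ifs <;> positivity

/-- Pascal's rule: monotonicity and convexity in c + 1 variables reduce to positivity and
monotonicity in c variables. -/
lemma succ_sub (c : ℕ) (i : ℤ) :
    polyHilbert (c + 1) i - polyHilbert (c + 1) (i - 1) = polyHilbert c i := by
  rcases lt_trichotomy i 0 with hi | rfl | hi
  · simp [of_neg _ hi, of_neg (c + 1) (show i - 1 < 0 by omega)]
  · rw [zero, zero, of_neg (c + 1) (by omega), sub_zero]
  · obtain ⟨n, rfl⟩ : ∃ n : ℕ, i = (n + 1 : ℕ) := ⟨(i - 1).toNat, by omega⟩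
    have : ((n + 1 : ℕ) : ℤ) - 1 = (n : ℤ) := by push_cast; ring
    rw [this, natCast, natCast, natCast, Nat.multichoose_succ_succ]
    push_cast; ring

lemma mono {c : ℕ} (hc : 1 ≤ c) : Monotone (polyHilbert c) := by
  obtain ⟨c, rfl⟩ := Nat.exists_eq_add_of_le' hc
  refine monotone_int_of_le_succ fun i => ?_
  have h := succ_sub c (i + 1)
  rw [add_sub_cancel_right] at h
  linarith [nonneg c (i + 1)]

lemma pos {c : ℕ} (hc : 1 ≤ c) {i : ℤ} (hi : 0 ≤ i) : 0 < polyHilbert c i := by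
  have := mono hc hi
  rw [zero] at this
  omega

lemma lt {c : ℕ} (hc : 2 ≤ c) {i j : ℤ} (hij : i < j) (hj : 0 ≤ j) :
    polyHilbert c i < polyHilbert c j := by
  obtain ⟨c, rfl⟩ := Nat.exists_eq_add_of_le' (show 1 ≤ c by omega)
  have h := succ_sub c j
  have h1 := mono (c := c + 1) (by omega) (show i ≤ j - 1 by omega)
  have h2 := pos (c := c) (by omega) hj
  linarith

lemma convex {c : ℕ} (hc : 2 ≤ c) {i j : ℤ} (hij : i ≤ j) {n : ℤ} (hn : 0 ≤ n) :
    polyHilbert c (i + n) - polyHilbert c i ≤ polyHilbert c (j + n) - polyHilbert c j := by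
  obtain ⟨c, rfl⟩ := Nat.exists_eq_add_of_le' (show 1 ≤ c by omega)
  induction n, hn using Int.leInduction with
  | base => simp
  | succ n hn ih =>
    have h1 := succ_sub c (i + (n + 1))
    have h2 := succ_sub c (j + (n + 1))
    rw [show i + (n + 1) - 1 = i + n by ring] at h1
    rw [show j + (n + 1) - 1 = j + n by ring] at h2
    have h3 := mono (c := c) (by omega) (show i + (n + 1) ≤ j + (n + 1) by omega)
    linarith

/-- Only the last of the n unit steps needs to be strict: first differences are values in c - 1 ≥ 2
variables, where `lt` applies. -/
lemma strictConvex {c : ℕ} (hc : 3 ≤ c) {i j : ℤ} (hij : i < j) {n : ℤ} (hn : 0 < n)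
    (hjn : 0 ≤ j + n) :
    polyHilbert c (i + n) - polyHilbert c i < polyHilbert c (j + n) - polyHilbert c j := by
  have h := convex (c := c) (by omega) hij.le (show 0 ≤ n - 1 by omega)
  obtain ⟨c, rfl⟩ := Nat.exists_eq_add_of_le' (show 1 ≤ c by omega)
  have h1 := succ_sub c (i + n)
  have h2 := succ_sub c (j + n)
  rw [show i + n - 1 = i + (n - 1) by ring] at h1
  rw [show j + n - 1 = j + (n - 1) by ring] at h2
  have h3 := lt (c := c) (by omega) (show i + n < j + n by omega) hjn
  linarith

/-- The linear formula persists at i = -1, where both sides are 0. -/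
lemma two_apply {i : ℤ} (hi : -1 ≤ i) : polyHilbert 2 i = i + 1 := by
  rcases hi.eq_or_lt with rfl | hi
  · exact of_neg _ (by norm_num)
  · obtain ⟨n, rfl⟩ : ∃ n : ℕ, i = n := ⟨i.toNat, by omega⟩
    simp [Nat.multichoose_two]

end polyHilbert

/-- The Hilbert function of a compressed level algebra of codimension `c`, socle degree `e` and
type `r`, extended by zero to `ℤ`. -/
def compressedHilbert (c : ℕ) (e r i : ℤ) : ℤ :=
  min (polyHilbert c i) (r * polyHilbert c (e - i))

namespace compressedHilbert

variable {c : ℕ} {e r i : ℤ}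

lemma le_left (c : ℕ) (e r i : ℤ) : compressedHilbert c e r i ≤ polyHilbert c i := min_le_left _ _

lemma le_right (c : ℕ) (e r i : ℤ) : compressedHilbert c e r i ≤ r * polyHilbert c (e - i) :=
  min_le_right _ _

lemma of_two_mul_le (hc : 1 ≤ c) (hr : 1 ≤ r) (hi : 2 * i ≤ e) :
    compressedHilbert c e r i = polyHilbert c i := by
  have h1 := polyHilbert.mono hc (show i ≤ e - i by omega)
  have h2 := le_mul_of_one_le_left (polyHilbert.nonneg c (e - i)) hr
  exact min_eq_left (h1.trans h2)

end compressedHilbert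

/-! ### The numerical contradiction. -/

set_option maxHeartbeats 1000000 in
open polyHilbert compressedHilbert in
/-- The Hilbert function of a compressed level algebra is not compatible with the relations that
an exact pair of zero divisors of degrees `d₁ ≤ d₂` imposes on it. -/
theorem compressedHilbert_not_exactPair_of_le {c : ℕ} {e r d₁ d₂ : ℤ} (hc : 2 ≤ c) (hr : 1 ≤ r)
    (hre : r ≤ polyHilbert c e) (he : 2 ≤ e) (hd₁ : 1 ≤ d₁) (hd : d₁ ≤ d₂) (hd₂ : d₂ ≤ e)
    (hlt : d₁ + d₂ ≤ e → compressedHilbert c e r (d₁ + d₂) < polyHilbert c (d₁ + d₂))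
    (h₁ : e < 2 * (d₁ + d₂) → ∀ i, e - d₁ < i → i ≤ e →
      compressedHilbert c e r i + compressedHilbert c e r (i - (d₁ + d₂)) =
        compressedHilbert c e r (i - d₂) + compressedHilbert c e r (i - (d₁ + d₂) - d₂))
    (h₂ : e < 2 * (d₁ + d₂) → ∀ i, e - d₂ < i → i ≤ e →
      compressedHilbert c e r i + compressedHilbert c e r (i - (d₁ + d₂)) =
        compressedHilbert c e r (i - d₁) + compressedHilbert c e r (i - (d₁ + d₂) - d₁))
    (h : (r = 1 ∧ e ≠ 3 ∧ 3 ≤ c) ∨ (2 ≤ r ∧ ¬ (e = 2 ∧ r = c - 1))) : False := by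
  have hc1 : 1 ≤ c := by omega
  have hone := one c
  have hzero := zero c
  have hlt' : d₁ + d₂ ≤ e → r * polyHilbert c (e - (d₁ + d₂)) < polyHilbert c (d₁ + d₂) := by
    intro hD
    have := hlt hD
    unfold compressedHilbert at this
    simpa using this
  have hD : e < 2 * (d₁ + d₂) := by
    by_contra hcon
    have h1 := hlt' (by omega)
    have h2 := mono hc1 (show d₁ + d₂ ≤ e - (d₁ + d₂) by omega)
    have h3 := le_mul_of_one_le_left (polyHilbert.nonneg c (e - (d₁ + d₂))) hr
    linarith
  replace h₁ := h₁ hD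
  replace h₂ := h₂ hD
  obtain ⟨j, rfl⟩ : ∃ j, e = j + (d₁ + d₂) := ⟨e - (d₁ + d₂), by ring⟩
  have hje : compressedHilbert c (j + (d₁ + d₂)) r (j + (d₁ + d₂)) = r := by
    unfold compressedHilbert
    rw [sub_self, hzero, mul_one]
    exact min_eq_right hre
  -- From e < 2D follows j < D, hence 2j < e.
  have low : ∀ i ≤ j, compressedHilbert c (j + (d₁ + d₂)) r i = polyHilbert c i :=
    fun i hi => of_two_mul_le hc1 hr (by omega)
  have f₁ := h₁ (j + (d₁ + d₂)) (by omega) le_rfl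
  have f₂ := h₂ (j + (d₁ + d₂)) (by omega) le_rfl
  rw [hje, show j + (d₁ + d₂) - (d₁ + d₂) = j by ring, low j le_rfl, low (j - d₂) (by omega),
    show j + (d₁ + d₂) - d₂ = j + d₁ by ring] at f₁
  rw [hje, show j + (d₁ + d₂) - (d₁ + d₂) = j by ring, low j le_rfl, low (j - d₁) (by omega),
    show j + (d₁ + d₂) - d₁ = j + d₂ by ring] at f₂
  rw [show j + (d₁ + d₂) - (d₁ + d₂) = j by ring] at hlt'
  have u₁ : compressedHilbert c (j + (d₁ + d₂)) r (j + d₁) =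
      min (polyHilbert c (j + d₁)) (r * polyHilbert c d₂) := by
    unfold compressedHilbert; congr 3; ring
  have u₂ : compressedHilbert c (j + (d₁ + d₂)) r (j + d₂) =
      min (polyHilbert c (j + d₂)) (r * polyHilbert c d₁) := by
    unfold compressedHilbert; congr 3; ring
  rw [u₁] at f₁
  rw [u₂] at f₂
  have hpd₁ : (c : ℤ) ≤ polyHilbert c d₁ := hone ▸ mono hc1 hd₁
  have hpd := mono hc1 hd
  rcases le_or_gt (r * polyHilbert c d₂) (polyHilbert c (j + d₁)) with hA | hB
  · have hmon := mono hc1 (show j + d₁ ≤ j + d₂ by omega)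
    have hrd : r * polyHilbert c d₁ ≤ r * polyHilbert c d₂ := by gcongr
    rw [min_eq_right hA] at f₁
    rw [min_eq_right (by linarith)] at f₂
    have hj : 0 ≤ j := by
      by_contra hj
      rw [of_neg c (show j < 0 by omega), of_neg c (show j - d₂ < 0 by omega)] at f₁
      nlinarith
    rcases hc.eq_or_lt with rfl | hc3
    · have hr2 : 2 ≤ r := by omega
      rw [two_apply (show -1 ≤ j by omega), two_apply (show -1 ≤ d₁ by omega)] at f₂
      rcases le_or_gt d₁ j with hdj | hdj
      · rw [two_apply (by omega)] at f₂
        nlinarith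
      · rw [of_neg 2 (by omega)] at f₂
        nlinarith
    rcases hd.eq_or_lt with rfl | hdlt
    swap
    -- Comparing `f₁` and `f₂` gives r(h(d₂) - h(d₁)) = h(j - d₁) - h(j - d₂), with the right-hand
    -- interval further left since j < D.
    · have := strictConvex hc3 (show j - d₂ < d₁ by omega) (show 0 < d₂ - d₁ by omega) (by omega)
      rw [show j - d₂ + (d₂ - d₁) = j - d₁ by ring, show d₁ + (d₂ - d₁) = d₂ by ring] at this
      nlinarith
    -- Now r(h(d₁) - h(0)) = h(j) - h(j - d₁), so strict convexity ties r to the sign of j - d₁.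
    have key : d₁ ≤ j ∧ (r = 1 → j = d₁) ∧ (2 ≤ r → d₁ + 1 ≤ j) := by
      rcases lt_trichotomy (j - d₁) 0 with hm | hm | hm
      · have := strictConvex hc3 hm (show 0 < d₁ by omega) (by omega)
        rw [sub_add_cancel, zero_add, hzero] at this
        nlinarith
      · refine ⟨by omega, by omega, fun hr2 => ?_⟩
        rw [hm, hzero, show j = d₁ by omega] at f₁
        nlinarith
      · refine ⟨by omega, fun hr1 => ?_, by omega⟩
        have := strictConvex hc3 hm (show 0 < d₁ by omega) (by omega)
        rw [sub_add_cancel, zero_add, hzero] at this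
        subst hr1
        linarith
    obtain ⟨hj1, hj2, hj3⟩ := key
    -- If r = 1 then e = 3d₁ and e ≠ 3; if r ≥ 2 then d₁ < j < 2d₁.
    have hd2 : 2 ≤ d₁ := by omega
    have hD' := hlt' (by omega)
    have hmid : r * polyHilbert c (d₁ + 1) ≤ polyHilbert c (j + d₁ - 1) := by
      rcases h with ⟨rfl, -⟩ | ⟨hr2, -⟩
      · rw [one_mul, hj2 rfl]
        exact mono hc1 (by omega)
      · have m1 := mono hc1 (hj3 hr2)
        have m2 := mono hc1 (show d₁ + d₁ ≤ j + d₁ - 1 by have := hj3 hr2; omega)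
        nlinarith
    -- In degree e - 1, H(e - 1) ≤ rc and convexity give h(d₁ + 1) ≤ c + h(d₁) - 1, against strict
    -- convexity.
    have g := h₁ (j + (d₁ + d₁) - 1) (by omega) (by omega)
    have hg1 := le_right c (j + (d₁ + d₁)) r (j + (d₁ + d₁) - 1)
    rw [sub_sub_cancel, hone] at hg1
    rw [show j + (d₁ + d₁) - 1 - d₁ = j + d₁ - 1 by ring,
      show j + (d₁ + d₁) - 1 - (d₁ + d₁) = j - 1 by ring, low (j - 1) (by omega),
      low (j - 1 - d₁) (by omega)] at g
    have hg2 : compressedHilbert c (j + (d₁ + d₁)) r (j + d₁ - 1) = r * polyHilbert c (d₁ + 1) := by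
      unfold compressedHilbert
      rw [show j + (d₁ + d₁) - (j + d₁ - 1) = d₁ + 1 by ring]
      exact min_eq_right hmid
    rw [hg2] at g
    have c1 := convex hc (show j - 1 - d₁ ≤ j - d₁ by omega) (show 0 ≤ d₁ by omega)
    rw [sub_add_cancel, sub_add_cancel] at c1
    have c2 := strictConvex hc3 (show (0 : ℤ) < 1 by omega) (show 0 < d₁ by omega) (by omega)
    rw [zero_add, add_comm 1 d₁, hzero, hone] at c2
    nlinarith
  · have hjd : j < d₂ := by
      by_contra hjd
      have h1 := hlt' (by omega)
      have h2 := mono hc1 (show d₂ ≤ j by omega)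
      have h3 := mono hc1 (show d₁ + d₂ ≤ j + d₁ by omega)
      nlinarith
    rw [min_eq_left hB.le, of_neg c (show j - d₂ < 0 by omega), add_zero] at f₁
    rcases le_total (polyHilbert c (j + d₂)) (r * polyHilbert c d₁) with hBi | hBi
    · rw [min_eq_left hBi] at f₂
      have nn := polyHilbert.nonneg c (j - d₁)
      rcases hd.eq_or_lt with rfl | hdlt
      swap
      · have := lt hc (show j + d₁ < j + d₂ by omega) (by omega)
        linarith
      have hd2 : 2 ≤ d₁ := by
        by_contra hd2
        -- Here e = 2 and `f₁` reads r + 1 = c, the excluded triple.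
        obtain rfl : d₁ = 1 := by omega
        obtain rfl : j = 0 := by omega
        rw [zero_add, hone, hzero] at f₁
        omega
      have g := h₁ (j + (d₁ + d₁) - 1) (by omega) (by omega)
      rw [show j + (d₁ + d₁) - 1 - d₁ = j + d₁ - 1 by ring,
        show j + (d₁ + d₁) - 1 - (d₁ + d₁) = j - 1 by ring, low (j - 1) (by omega),
        low (j - 1 - d₁) (by omega),
        of_neg c (show j - 1 - d₁ < 0 by omega), add_zero] at g
      have g1 := le_left c (j + (d₁ + d₁)) r (j + d₁ - 1)
      unfold compressedHilbert at g g1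
      rw [sub_sub_cancel, hone] at g
      -- The first value of H(e - 1) contradicts growth of h; the second gives rc ≤ h(j + d₁) - h(j)
      -- = r by convexity.
      rcases min_choice (polyHilbert c (j + (d₁ + d₁) - 1)) (r * (c : ℤ)) with hm | hm
      · rw [hm] at g
        have := lt hc (show j + d₁ - 1 < j + (d₁ + d₁) - 1 by omega) (by omega)
        linarith [polyHilbert.nonneg c (j - 1)]
      · rw [hm] at g
        have := convex hc (show j - 1 ≤ j by omega) (show 0 ≤ d₁ by omega)
        rw [show j - 1 + d₁ = j + d₁ - 1 by ring] at this
        have : (2 : ℤ) ≤ c := by exact_mod_cast hc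
        nlinarith
    · rw [min_eq_right hBi] at f₂
      -- By `f₁`, h(j + d₁) - h(j) = r, so h(j) - h(j - d₁) ≤ r and `f₂` yields h(d₁) ≤ 2. Only c =
      -- 2 needs more work.
      have hconv := convex hc (show j - d₁ ≤ j by omega) (show 0 ≤ d₁ by omega)
      rw [sub_add_cancel] at hconv
      rcases hc.eq_or_lt with rfl | hc3
      · have hr2 : 2 ≤ r := by omega
        rcases lt_or_ge j (-1) with hj | hj
        · rw [of_neg 2 (show j < 0 by omega), of_neg 2 (show j - d₁ < 0 by omega)] at *
          push_cast at hpd₁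
          nlinarith
        · rw [two_apply hj, two_apply (show -1 ≤ j + d₁ by omega)] at f₁
          rw [two_apply (show -1 ≤ d₁ by omega)] at f₂
          have : r = d₁ := by linarith
          subst this
          have e1 := two_apply (show -1 ≤ j + r by omega)
          have e2 := two_apply hj
          have e3 : r * (r + 1) ≤ 2 * r := by linarith
          clear * - e3 hr2
          nlinarith
      · have : (3 : ℤ) ≤ c := by exact_mod_cast hc3
        nlinarith

/-- The Hilbert function of a compressed level algebra is not compatible with the relations that
an exact pair of zero divisors of degrees `d₁` and `d₂` imposes on it. -/
theorem compressedHilbert_not_exactPair {c : ℕ} {e r d₁ d₂ : ℤ} (hc : 2 ≤ c)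
    (he : 2 ≤ e) (hd₁ : 1 ≤ d₁) (hd₂ : 1 ≤ d₂) (hd₁e : d₁ ≤ e) (hd₂e : d₂ ≤ e)
    (hlt : d₁ + d₂ ≤ e → compressedHilbert c e r (d₁ + d₂) < polyHilbert c (d₁ + d₂))
    (h₁ : e < 2 * (d₁ + d₂) → ∀ i, e - d₁ < i → i ≤ e →
      compressedHilbert c e r i + compressedHilbert c e r (i - (d₁ + d₂)) =
        compressedHilbert c e r (i - d₂) + compressedHilbert c e r (i - (d₁ + d₂) - d₂))
    (h₂ : e < 2 * (d₁ + d₂) → ∀ i, e - d₂ < i → i ≤ e →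
      compressedHilbert c e r i + compressedHilbert c e r (i - (d₁ + d₂)) =
        compressedHilbert c e r (i - d₁) + compressedHilbert c e r (i - (d₁ + d₂) - d₁))
    (h : (r = 1 ∧ e ≠ 3 ∧ 3 ≤ c) ∨ (2 ≤ r ∧ ¬ (e = 2 ∧ r = c - 1))) : False := by
  have hpe : (c : ℤ) < polyHilbert c e := by
    simpa [polyHilbert.one] using polyHilbert.lt hc (show 1 < e by omega) (by omega)
  -- Lowering r to h(e) does not change the minimum: up to degree e it is h(i) either way.
  wlog hre : r ≤ polyHilbert c e generalizing r
  · have hH : compressedHilbert c e (polyHilbert c e) = compressedHilbert c e r := by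
      funext i
      rcases le_or_gt i e with hi | hi
      · have m := polyHilbert.mono (c := c) (by omega) hi
        have q := polyHilbert.pos (c := c) (by omega) (show 0 ≤ e - i by omega)
        unfold compressedHilbert
        rw [min_eq_left (by nlinarith), min_eq_left (by nlinarith)]
      · simp [compressedHilbert, polyHilbert.of_neg c (show e - i < 0 by omega)]
    refine this (r := polyHilbert c e) ?_ ?_ ?_ ?_ le_rfl
    · rwa [hH]
    · rwa [hH]
    · rwa [hH]
    · exact Or.inr ⟨by omega, by omega⟩
  rcases le_total d₁ d₂ with hd | hd
  · exact compressedHilbert_not_exactPair_of_le hc (by omega) hre he hd₁ hd hd₂e hlt h₁ h₂ h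
  · rw [add_comm d₁ d₂] at hlt h₁ h₂
    exact compressedHilbert_not_exactPair_of_le hc (by omega) hre he hd₂ hd hd₁e hlt h₂ h₁ h

/-! ### Dimensions of spaces of forms and of images. -/

theorem finrank_homogeneousSubmodule {k : Type*} [Field k] (c n : ℕ) :
    Module.finrank k (homogeneousSubmodule (Fin c) k n) = Nat.multichoose c n := by
  classical
  rw [homogeneousSubmodule_eq_finsupp_supported]
  have hs : {d : Fin c →₀ ℕ | d.degree = n} =
      ((Finset.univ.finsuppAntidiag n : Finset (Fin c →₀ ℕ)) : Set (Fin c →₀ ℕ)) := by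
    ext d
    simp [Finset.mem_finsuppAntidiag, Finsupp.degree_eq_sum]
  rw [hs]
  rw [(AddMonoidAlgebra.supportedEquivFinsupp _).finrank_eq, Module.finrank_finsupp_self]
  simp [Finset.card_finsuppAntidiag_nat_eq_multichoose]

noncomputable section

theorem Submodule.finrank_map_add_finrank_inf_ker {k V W : Type*} [Field k] [AddCommGroup V]
    [Module k V] [AddCommGroup W] [Module k W] (f : V →ₗ[k] W) (U : Submodule k V)
    [FiniteDimensional k U] :
    Module.finrank k (U.map f) + Module.finrank k (U ⊓ LinearMap.ker f : Submodule k V) =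
      Module.finrank k U := by
  have h := (f.domRestrict U).finrank_range_add_finrank_ker
  rw [LinearMap.range_domRestrict, LinearMap.ker_domRestrict] at h
  rw [← h, ← Submodule.map_comap_subtype, Submodule.finrank_map_subtype_eq]

/-! ### Homogeneous partners. -/

section

attribute [local instance] MvPolynomial.gradedAlgebra

theorem MvPolynomial.IsHomogeneous.homogeneousComponent_mul {σ R : Type*} [CommSemiring R]
    {f : MvPolynomial σ R} {d : ℕ} (hf : f.IsHomogeneous d) (g : MvPolynomial σ R) (n : ℕ) :
    homogeneousComponent n (f * g) =
      if d ≤ n then f * homogeneousComponent (n - d) g else 0 := by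
  classical
  have h := DirectSum.coe_decompose_mul_of_left_mem (homogeneousSubmodule σ R) (b := g) n
    ((mem_homogeneousSubmodule d f).2 hf)
  have key (p : MvPolynomial σ R) (m : ℕ) :
      (DirectSum.decompose (homogeneousSubmodule σ R) p m : MvPolynomial σ R) =
        homogeneousComponent m p := decomposition.decompose'_apply p m
  rwa [key, key] at h

namespace GradedQuotient

variable {k : Type*} [Field k] {c : ℕ} {I : Ideal (MvPolynomial (Fin c) k)}

theorem GeneratedInDegreeGETwo.isHomogeneous (hI : GeneratedInDegreeGETwo I) :
    I.IsHomogeneous (homogeneousSubmodule (Fin c) k) := by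
  obtain ⟨G, hG, rfl⟩ := hI
  refine Ideal.homogeneous_span _ _ fun x hx => ?_
  obtain ⟨d, -, hd⟩ := hG x hx
  exact ⟨d, hd⟩

variable (hI : I.IsHomogeneous (homogeneousSubmodule (Fin c) k))

theorem mem_component {i : ℕ} {s : MvPolynomial (Fin c) k ⧸ I} :
    s ∈ component I i ↔ ∃ f, f.IsHomogeneous i ∧ Ideal.Quotient.mk I f = s := Iff.rfl

theorem mem_of_component_eq_bot {f : MvPolynomial (Fin c) k} {d : ℕ} (hf : f.IsHomogeneous d)
    (h : component I d = ⊥) : f ∈ I := by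
  have : Ideal.Quotient.mk I f ∈ component I d := ⟨f, hf, rfl⟩
  rw [h] at this
  exact Ideal.Quotient.eq_zero_iff_mem.1 this

theorem isNilpotent_mk_of_coeff_zero {e : ℕ} (he : HasSocleDegree I e)
    {f : MvPolynomial (Fin c) k} (hf : coeff 0 f = 0) : IsNilpotent (Ideal.Quotient.mk I f) := by
  have hspan : f ∈ idealOfVars (Fin c) k := by
    have := mem_pow_idealOfVars_iff' (R := k) 1 f
    rw [pow_one] at this
    refine this.2 fun x hx => ?_
    rw [(Finsupp.degree_eq_zero_iff x).1 (by omega)]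
    exact hf
  have hle : idealOfVars (Fin c) k ≤ (nilradical _).comap (Ideal.Quotient.mk I) := by
    rw [idealOfVars, Ideal.span_le]
    rintro _ ⟨j, rfl⟩
    refine ⟨e + 1, ?_⟩
    rw [← map_pow]
    refine Ideal.Quotient.eq_zero_iff_mem.2 ?_
    refine mem_of_component_eq_bot (isHomogeneous_X_pow j (e + 1)) ?_
    by_contra hne
    have := he.2 hne
    omega
  exact hle hspan

include hI in
/-- The partner of a homogeneous exact zero divisor can be chosen homogeneous. -/
theorem exists_homogeneous_partner {e : ℕ} (he : HasSocleDegree I e)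
    {f : MvPolynomial (Fin c) k} {d : ℕ} (hf : f.IsHomogeneous d)
    (h : IsExactZeroDivisor (Ideal.Quotient.mk I f)) :
    ∃ (d' : ℕ) (g : MvPolynomial (Fin c) k), g.IsHomogeneous d' ∧
      IsExactPair (Ideal.Quotient.mk I f) (Ideal.Quotient.mk I g) := by
  classical
  obtain ⟨b, hb⟩ := h
  obtain ⟨g, rfl⟩ := Ideal.Quotient.mk_surjective b
  have hg : g ∉ I := fun hg => hb.right_ne_zero (Ideal.Quotient.eq_zero_iff_mem.2 hg)
  have hex : ∃ n, homogeneousComponent n g ∉ I := by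
    by_contra hcon
    push Not at hcon
    exact hg ((mem_iff_homogeneousComponent_mem hI g).2 hcon)
  -- The lowest component of g outside I will be the new partner: it is killed by f, so it is gs
  -- modulo I for some s.
  set m := Nat.find hex with hm
  have hmI : homogeneousComponent m g ∉ I := Nat.find_spec hex
  have hmin : ∀ n < m, homogeneousComponent n g ∈ I := fun n hn =>
    not_not.1 (Nat.find_min hex hn)
  have hfg : f * g ∈ I := by
    have : Ideal.Quotient.mk I g ∈ (Ideal.span {Ideal.Quotient.mk I f}).annihilator := by
      rw [hb.annihilator_left]; exact Ideal.mem_span_singleton_self _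
    rw [Submodule.mem_annihilator_span_singleton, smul_eq_mul, ← map_mul,
      Ideal.Quotient.eq_zero_iff_mem, mul_comm] at this
    exact this
  have hfgm : f * homogeneousComponent m g ∈ I := by
    have := homogeneousComponent_mem_of_mem hI hfg (d + m)
    rwa [hf.homogeneousComponent_mul, if_pos (by omega), Nat.add_sub_cancel_left] at this
  obtain ⟨s, hs⟩ : ∃ s, homogeneousComponent m g - g * s ∈ I := by
    have : Ideal.Quotient.mk I (homogeneousComponent m g) ∈ Ideal.span {Ideal.Quotient.mk I g} := by
      rw [← hb.annihilator_left, Submodule.mem_annihilator_span_singleton, smul_eq_mul, ← map_mul,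
        Ideal.Quotient.eq_zero_iff_mem, mul_comm]
      exact hfgm
    obtain ⟨s, hs⟩ := Ideal.mem_span_singleton'.1 this
    obtain ⟨s, rfl⟩ := Ideal.Quotient.mk_surjective s
    refine ⟨s, Ideal.Quotient.eq.1 ?_⟩
    rw [← hs, map_mul, mul_comm]
  have hgm : (homogeneousComponent m g).IsHomogeneous m := homogeneousComponent_isHomogeneous m g
  have hcomp : homogeneousComponent m (g * s) - homogeneousComponent m g * C (coeff 0 s) ∈ I := by
    have hsum : homogeneousComponent m (g * s) =
        ∑ i ∈ Finset.range (g.totalDegree + 1),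
          homogeneousComponent m (homogeneousComponent i g * s) := by
      conv_lhs => rw [← sum_homogeneousComponent g, Finset.sum_mul, map_sum]
    have hmd : m ∈ Finset.range (g.totalDegree + 1) := by
      rw [Finset.mem_range]
      by_contra hcon
      exact hmI (by rw [homogeneousComponent_eq_zero m g (by omega)]; exact I.zero_mem)
    rw [hsum, ← Finset.add_sum_erase _ _ hmd, hgm.homogeneousComponent_mul, if_pos le_rfl,
      Nat.sub_self, homogeneousComponent_zero, add_sub_cancel_left]
    refine I.sum_mem fun i hi => ?_
    rw [(homogeneousComponent_isHomogeneous i g).homogeneousComponent_mul]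
    split_ifs with him
    · refine I.mul_mem_right _ (hmin i ?_)
      have := Finset.ne_of_mem_erase hi
      omega
    · exact I.zero_mem
  -- In degree m, gs reduces modulo I to the component of g times the constant term of s. That term
  -- is therefore 1, and s is a unit modulo I.
  have hs0 : coeff 0 s = 1 := by
    by_contra hne
    have h1 := homogeneousComponent_mem_of_mem hI hs m
    rw [map_sub, homogeneousComponent_eq_self hgm] at h1
    have h2 := I.add_mem h1 hcomp
    have h3 : homogeneousComponent m g - homogeneousComponent m (g * s) +
        (homogeneousComponent m (g * s) - homogeneousComponent m g * C (coeff 0 s)) =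
        homogeneousComponent m g * C (1 - coeff 0 s) := by
      rw [C_sub, C_1]; ring
    rw [h3] at h2
    have h4 := I.mul_mem_right (C (1 - coeff 0 s)⁻¹) h2
    rw [mul_assoc, ← C_mul, mul_inv_cancel₀ (sub_ne_zero.2 (Ne.symm hne)), C_1, mul_one] at h4
    exact hmI h4
  have hunit : IsUnit (Ideal.Quotient.mk I s) := by
    have hn : IsNilpotent (Ideal.Quotient.mk I (s - 1)) :=
      isNilpotent_mk_of_coeff_zero he (by simp [hs0])
    have := hn.isUnit_one_add
    rwa [← map_one (Ideal.Quotient.mk I), ← map_add, add_sub_cancel] at this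
  have hspan : Ideal.span {Ideal.Quotient.mk I (homogeneousComponent m g)} =
      Ideal.span {Ideal.Quotient.mk I g} := by
    rw [Ideal.Quotient.eq.2 hs, map_mul]
    exact Ideal.span_singleton_mul_right_unit hunit _
  refine ⟨m, _, hgm, hb.left_ne_zero, ?_, ?_, ?_⟩
  · rwa [Ne, Ideal.Quotient.eq_zero_iff_mem]
  · rw [hspan, hb.annihilator_left]
  · rw [hspan, hb.annihilator_right]

end GradedQuotient

/-! ### Dimension counts for an exact pair. -/

theorem IsExactPair.symm {S : Type*} [CommRing S] {a b : S} (h : IsExactPair a b) :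
    IsExactPair b a :=
  ⟨h.right_ne_zero, h.left_ne_zero, h.annihilator_right, h.annihilator_left⟩

theorem IsExactPair.mul_eq_zero_iff {S : Type*} [CommRing S] {a b : S} (h : IsExactPair a b)
    {s : S} : a * s = 0 ↔ ∃ t, b * t = s := by
  have : s ∈ (Ideal.span {a}).annihilator ↔ s ∈ Ideal.span {b} := by rw [h.annihilator_left]
  rw [Submodule.mem_annihilator_span_singleton, smul_eq_mul, mul_comm,
    Ideal.mem_span_singleton'] at this
  simpa only [mul_comm] using this

theorem IsExactPair.not_isUnit {S : Type*} [CommRing S] {a b : S} (h : IsExactPair a b) :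
    ¬ IsUnit a := fun ha => by
  have := (h.mul_eq_zero_iff (s := b)).2 ⟨1, mul_one b⟩
  exact h.right_ne_zero (ha.mul_right_eq_zero.1 this)

namespace GradedQuotient

variable {k : Type*} [Field k] {c : ℕ} {I : Ideal (MvPolynomial (Fin c) k)}

theorem one_le_of_isExactPair {f : MvPolynomial (Fin c) k} {d : ℕ} (hf : f.IsHomogeneous d)
    {b : MvPolynomial (Fin c) k ⧸ I} (h : IsExactPair (Ideal.Quotient.mk I f) b) : 1 ≤ d := by
  by_contra hd
  obtain rfl : d = 0 := by omega
  rw [← homogeneousComponent_eq_self hf, homogeneousComponent_zero] at h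
  have h0 : coeff 0 f ≠ 0 := fun h0 => h.left_ne_zero (by simp [h0])
  exact h.not_isUnit (((isUnit_iff_ne_zero.2 h0).map C).map (Ideal.Quotient.mk I))

variable (I) in
/-- The homogeneous components of `S = P / I`, extended by zero to negative degrees. -/
def intComponent (i : ℤ) : Submodule k (MvPolynomial (Fin c) k ⧸ I) :=
  if i < 0 then ⊥ else component I i.toNat

theorem intComponent_of_neg {i : ℤ} (hi : i < 0) : intComponent I i = ⊥ := if_pos hi

@[simp] theorem intComponent_natCast (n : ℕ) : intComponent I (n : ℤ) = component I n := by
  simp [intComponent]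

instance finiteDimensional_component (i : ℕ) : FiniteDimensional k (component I i) := by
  have : FiniteDimensional k (homogeneousSubmodule (Fin c) k i) :=
    Module.Finite.iff_fg.2 (homogeneousSubmodule_fg (Fin c) k i)
  unfold component
  infer_instance

instance finiteDimensional_intComponent (i : ℤ) : FiniteDimensional k (intComponent I i) := by
  rcases lt_or_ge i 0 with hi | hi
  · rw [intComponent_of_neg hi]
    infer_instance
  · obtain ⟨n, rfl⟩ := Int.eq_ofNat_of_zero_le hi
    rw [intComponent_natCast]
    infer_instance

theorem map_mulLeft_intComponent_le {f : MvPolynomial (Fin c) k} {d : ℕ} (hf : f.IsHomogeneous d)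
    (i : ℤ) :
    (intComponent I i).map (LinearMap.mulLeft k (Ideal.Quotient.mk I f)) ≤
      intComponent I (i + d) := by
  rcases lt_or_ge i 0 with hi | hi
  · simp [intComponent_of_neg hi]
  · obtain ⟨n, rfl⟩ := Int.eq_ofNat_of_zero_le hi
    rw [← Nat.cast_add, intComponent_natCast, intComponent_natCast]
    rintro _ ⟨_, ⟨g, hg, rfl⟩, rfl⟩
    exact ⟨f * g, by simpa [add_comm n d] using hf.mul hg, by simp⟩

theorem intComponent_inf_ker_mulLeft (hI : I.IsHomogeneous (homogeneousSubmodule (Fin c) k))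
    {f g : MvPolynomial (Fin c) k} {d' : ℕ} (hg : g.IsHomogeneous d')
    (h : IsExactPair (Ideal.Quotient.mk I f) (Ideal.Quotient.mk I g)) (i : ℤ) :
    intComponent I i ⊓ LinearMap.ker (LinearMap.mulLeft k (Ideal.Quotient.mk I f)) =
      (intComponent I (i - d')).map (LinearMap.mulLeft k (Ideal.Quotient.mk I g)) := by
  apply le_antisymm
  · rintro s ⟨hs, hsk⟩
    rcases lt_or_ge i 0 with hi | hi
    · rw [SetLike.mem_coe, intComponent_of_neg hi, Submodule.mem_bot] at hs
      rw [hs]; exact Submodule.zero_mem _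
    obtain ⟨n, rfl⟩ := Int.eq_ofNat_of_zero_le hi
    rw [SetLike.mem_coe, intComponent_natCast] at hs
    obtain ⟨p, hp, rfl⟩ := mem_component.1 hs
    obtain ⟨t, ht⟩ := h.mul_eq_zero_iff.1 (LinearMap.mem_ker.1 hsk)
    obtain ⟨t, rfl⟩ := Ideal.Quotient.mk_surjective t
    rw [← map_mul, Ideal.Quotient.eq] at ht
    have h1 := homogeneousComponent_mem_of_mem hI ht n
    rw [map_sub, homogeneousComponent_eq_self hp, hg.homogeneousComponent_mul] at h1
    rw [← Ideal.Quotient.eq.2 h1]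
    split_ifs with hn
    · refine ⟨Ideal.Quotient.mk I (homogeneousComponent (n - d') t), ?_, by simp⟩
      rw [← Nat.cast_sub hn, intComponent_natCast]
      exact ⟨_, homogeneousComponent_isHomogeneous _ _, rfl⟩
    · rw [map_zero]; exact Submodule.zero_mem _
  · refine le_inf ?_ ?_
    · simpa using map_mulLeft_intComponent_le (I := I) hg (i - d')
    · rintro _ ⟨t, -, rfl⟩
      exact h.mul_eq_zero_iff.2 ⟨t, rfl⟩

theorem finrank_map_mulLeft_add (hI : I.IsHomogeneous (homogeneousSubmodule (Fin c) k))
    {f g : MvPolynomial (Fin c) k} {d' : ℕ} (hg : g.IsHomogeneous d')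
    (h : IsExactPair (Ideal.Quotient.mk I f) (Ideal.Quotient.mk I g)) (i : ℤ) :
    Module.finrank k ((intComponent I i).map (LinearMap.mulLeft k (Ideal.Quotient.mk I f))) +
      Module.finrank k
        ((intComponent I (i - d')).map (LinearMap.mulLeft k (Ideal.Quotient.mk I g))) =
      Module.finrank k (intComponent I i) := by
  rw [← intComponent_inf_ker_mulLeft hI hg h]
  exact Submodule.finrank_map_add_finrank_inf_ker _ _

theorem HasSocleDegree.intComponent_eq_bot {e : ℕ} (he : HasSocleDegree I e) {i : ℤ}
    (hi : (e : ℤ) < i) : intComponent I i = ⊥ := by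
  obtain ⟨n, rfl⟩ := Int.eq_ofNat_of_zero_le (show 0 ≤ i by omega)
  rw [intComponent_natCast]
  by_contra hne
  have := he.2 hne
  omega

/-- The relation on Hilbert functions coming from an exact pair of homogeneous zero divisors. -/
theorem HasSocleDegree.finrank_intComponent_of_isExactPair {e : ℕ} (he : HasSocleDegree I e)
    (hI : I.IsHomogeneous (homogeneousSubmodule (Fin c) k))
    {f g : MvPolynomial (Fin c) k} {d d' : ℕ} (hf : f.IsHomogeneous d) (hg : g.IsHomogeneous d')
    (h : IsExactPair (Ideal.Quotient.mk I f) (Ideal.Quotient.mk I g)) {i : ℤ}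
    (hi : (e : ℤ) - d < i) (hi' : i < 2 * (d + d')) :
    Module.finrank k (intComponent I i) + Module.finrank k (intComponent I (i - (d + d'))) =
      Module.finrank k (intComponent I (i - d')) +
        Module.finrank k (intComponent I (i - (d + d') - d')) := by
  -- Four consecutive rank-nullity counts, whose alternating sum telescopes: the image of [S]_i
  -- under f vanishes above degree e, and the last source lies in negative degree.
  have e1 := finrank_map_mulLeft_add hI hg h i
  have e2 := finrank_map_mulLeft_add hI hf h.symm (i - d')
  have e3 := finrank_map_mulLeft_add hI hg h (i - (d + d'))
  have e4 := finrank_map_mulLeft_add hI hf h.symm (i - (d + d') - d')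
  have z1 := map_mulLeft_intComponent_le (I := I) hf i
  rw [he.intComponent_eq_bot (show (e : ℤ) < i + d by omega), le_bot_iff] at z1
  rw [z1, finrank_bot, zero_add] at e1
  rw [show i - d' - d = i - (d + d') by ring] at e2
  rw [intComponent_of_neg (show i - (d + d') - d' - d < 0 by omega), Submodule.map_bot,
    finrank_bot, add_zero] at e4
  omega

theorem finrank_component_lt {f : MvPolynomial (Fin c) k} {d : ℕ} (hf : f.IsHomogeneous d)
    (hf0 : f ≠ 0) (hfI : f ∈ I) :
    Module.finrank k (component I d) < Module.finrank k (homogeneousSubmodule (Fin c) k d) := by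
  have : FiniteDimensional k (homogeneousSubmodule (Fin c) k d) :=
    Module.Finite.iff_fg.2 (homogeneousSubmodule_fg (Fin c) k d)
  have h := Submodule.finrank_map_add_finrank_inf_ker (Ideal.Quotient.mkₐ k I).toLinearMap
    (homogeneousSubmodule (Fin c) k d)
  have hpos : 0 < Module.finrank k (homogeneousSubmodule (Fin c) k d ⊓
      LinearMap.ker (Ideal.Quotient.mkₐ k I).toLinearMap : Submodule k _) := by
    refine Submodule.one_le_finrank_iff.2 ((Submodule.ne_bot_iff _).2 ⟨f, ⟨hf, ?_⟩, hf0⟩)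
    exact Ideal.Quotient.eq_zero_iff_mem.2 hfI
  change Module.finrank k (component I d) + _ = _ at h
  omega

theorem IsCompressedLevel.finrank_intComponent {e r : ℕ} (hS : IsCompressedLevel I e r) (i : ℤ) :
    (Module.finrank k (intComponent I i) : ℤ) = compressedHilbert c e r i := by
  rcases lt_or_ge i 0 with hi | hi
  · rw [intComponent_of_neg hi, finrank_bot, compressedHilbert, polyHilbert.of_neg c hi]
    exact (min_eq_left (mul_nonneg (by positivity) (polyHilbert.nonneg _ _))).symm
  rcases lt_or_ge (e : ℤ) i with hie | hie
  · rw [hS.hasSocleDegree.intComponent_eq_bot hie, finrank_bot, compressedHilbert,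
      polyHilbert.of_neg c (show (e : ℤ) - i < 0 by omega), mul_zero]
    exact (min_eq_right (polyHilbert.nonneg _ _)).symm
  obtain ⟨n, rfl⟩ := Int.eq_ofNat_of_zero_le hi
  have hn : n ≤ e := by omega
  have h := hS.hilbertFunction_eq n hn
  rw [finrank_homogeneousSubmodule, finrank_homogeneousSubmodule, hilbertFunction] at h
  rw [intComponent_natCast, h, compressedHilbert, ← Nat.cast_sub hn, polyHilbert.natCast,
    polyHilbert.natCast]
  push_cast
  rfl

end GradedQuotient

end

end

/-! ### Transfer of the numerical contradiction to S. -/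

theorem proposition3p9 {k : Type*} [Field k] (c e r : ℕ)
    (I : Ideal (MvPolynomial (Fin c) k))
    (hI : GradedQuotient.GeneratedInDegreeGETwo I)
    (hArt : IsArtinianRing (MvPolynomial (Fin c) k ⧸ I))
    (hS : GradedQuotient.IsCompressedLevel I e r)
    (h : (r = 1 ∧ 2 ≤ e ∧ e ≠ 3 ∧ 3 ≤ c) ∨
      (2 ≤ c ∧ 2 ≤ e ∧ 2 ≤ r ∧ (c, e, r) ≠ (c, 2, c - 1))) :
    ¬ ∃ θ : MvPolynomial (Fin c) k ⧸ I,
      (∃ i : ℕ, θ ∈ GradedQuotient.component I i) ∧ IsExactZeroDivisor θ := by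
  rintro ⟨_, ⟨d₁, f, hf, rfl⟩, hθ⟩
  have he := hS.hasSocleDegree
  have hhom := hI.isHomogeneous
  obtain ⟨d₂, g, hg, hfg⟩ := GradedQuotient.exists_homogeneous_partner hhom he hf hθ
  have le_e {f g : MvPolynomial (Fin c) k} {d : ℕ} (hf : f.IsHomogeneous d)
      (hfg : IsExactPair (Ideal.Quotient.mk I f) (Ideal.Quotient.mk I g)) : d ≤ e :=
    he.2 fun hbot => hfg.left_ne_zero
      (Ideal.Quotient.eq_zero_iff_mem.2 (GradedQuotient.mem_of_component_eq_bot hf hbot))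
  have ne_zero {f g : MvPolynomial (Fin c) k}
      (hfg : IsExactPair (Ideal.Quotient.mk I f) (Ideal.Quotient.mk I g)) : f ≠ 0 := by
    rintro rfl
    exact hfg.left_ne_zero (map_zero _)
  have hd₁ := GradedQuotient.one_le_of_isExactPair hf hfg
  have hd₂ := GradedQuotient.one_le_of_isExactPair hg hfg.symm
  have hd₁e := le_e hf hfg
  have hd₂e := le_e hg hfg.symm
  refine compressedHilbert_not_exactPair (c := c) (e := e) (r := r) (d₁ := d₁) (d₂ := d₂)
    (by omega) (by omega) (by omega) (by omega) (by omega) (by omega) ?_ ?_ ?_ ?_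
  · intro _
    have hmem : f * g ∈ I := by
      rw [← Ideal.Quotient.eq_zero_iff_mem, map_mul]
      exact hfg.mul_eq_zero_iff.2 ⟨1, mul_one _⟩
    have hlt := GradedQuotient.finrank_component_lt (hf.mul hg)
      (mul_ne_zero (ne_zero hfg) (ne_zero hfg.symm)) hmem
    rw [finrank_homogeneousSubmodule] at hlt
    rw [← hS.finrank_intComponent, ← Nat.cast_add, GradedQuotient.intComponent_natCast,
      polyHilbert.natCast]
    exact_mod_cast hlt
  · intro hD i hi hie
    have := he.finrank_intComponent_of_isExactPair hhom hf hg hfg hi (by omega)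
    simp only [← hS.finrank_intComponent]
    exact_mod_cast this
  · intro hD i hi hie
    have := he.finrank_intComponent_of_isExactPair hhom hg hf hfg.symm hi (by omega)
    simp only [← hS.finrank_intComponent]
    rw [add_comm (d₂ : ℤ) d₁] at this
    exact_mod_cast this
  · rcases h with ⟨hr, -, he3, hc⟩ | ⟨hc, -, hr, hne⟩
    · exact Or.inl ⟨by omega, by omega, hc⟩
    · refine Or.inr ⟨by omega, fun ⟨h1, h2⟩ => hne ?_⟩
      rw [show e = 2 by omega, show r = c - 1 by omega]
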